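/- Let $G$ be a group, $H_1,\dots,H_n$ ($n\ge 1$) a non-empty finite family of subgroups of $G$, and $\varphi\colon G\to G'$ an isomorphism onto a copy $G'$ of $G$. Let $(\mathcal G,X)$ be the graph of groups with two vertices $s,s'$ and $n$ edges $\alpha_1,\dots,\alpha_n$ from $s$ to $s'$, with vertex groups $G_s=G$ and $G_{s'}=G'$, and with $i$-th edge group $H_i$, mapped to $G_s=G$ by the inclusion and to $G_{s'}=G'$ by $\varphi|_{H_i}$. The double $2G$ of $G$ along $H_1,\dots,H_n$ is the fundamental group $\pi_1(\mathcal G,X,s)$, that is, the group, under concatenation, of loops $(g_0,a_1,g_1,\dots,a_m,g_m)$ (where $m\ge 0$, $(a_1,\dots,a_m)$ is a closed edge path at $s$, edges being followed in either direction, and each $g_j$ lies in the group of the vertex reached after $j$ edges) modulo the equivalence relation generated by replacing, inside a loop, $(g,a,\phi_{-a}(h),-a,\phi_a(h)^{-1})$ by $(g)$ and $(g,a,1,-a,g')$ by $(gg')$. Here $a$ is any edge in either direction, $-a$ is the opposite edge, $g,g'$ lie in the group of the origin of $a$, $h$ lies in the edge group, and $\phi_a$, $\phi_{-a}$ are the embeddings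 of the edge group in the groups of the origin and of the end of $a$ respectively. Then: (1) The natural homomorphism $\iota\colon G\to 2G$, $g\mapsto [(g)]$, is injective. (2) For all $u,v\in G$, $\iota(u)$ and $\iota(v)$ are conjugate in $2G$ if and only if $u$ and $v$ are conjugate in $G$. (3) Hence the conjugacy problem for $G$ reduces to the conjugacy problem for $2G$. For a family of generators $x$ of a group $\Gamma$, the conjugacy problem of $\Gamma$ with respect to $x$ is to decide whether two given words in the $x_a^{\pm1}$ represent conjugate elements of $\Gamma$. If $G$ is finitely generated, then so is $2G$, and for every finite generating family $x$ of $G$ and every finite generating family $y$ of $2G$, the conjugacy problem of $G$ with respect to $x$ is many-one reducible to that of $2G$ with respect to $y$. More generally, if $x=(x_a)_{a\in A}$ generates $G$ and $(\iota(x_a))_{a\in A}\cup(z_b)_{b\in B}$ generates $2G$, where the alphabets $A,B$ are finite or countably infinite and effectively (primitive recursively) coded, then the conjugacy problem of $G$ with respect to $x$ is many-one reducible to that of $2G$ with respect to this generating family, indexed by the disjoint union $A\sqcup B$. -/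

import Mathlib

universe u v w

/-- A graph of groups on a finite connected oriented graph, with vertex set `V` and set of
positively oriented edges `E`. The full set of edges of the underlying graph is formed by the
positive edges `a : E`, going from `o a` to `e a`, and by their opposites `-a`, going from
`e a` to `o a`. For every positive edge `a` the edge group `edgeGroup a` is equipped with
monomorphisms `phi a` (written `φ_a`) to the group of the origin of `a` and `phiNeg a`
(written `φ_{-a}`) to the group of its extremity. -/
structure GraphOfGroups (V : Type v) (E : Type w) where
  finite_vertices : Finite V
  finite_edges : Finite E
  o : E → V
  e : E → V
  /-- any two vertices are joined by an edge path (an edge may be followed in both directions) -/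
  connected : ∀ s t : V, Relation.ReflTransGen
    (fun p q => ∃ a : E, (o a = p ∧ e a = q) ∨ (e a = p ∧ o a = q)) s t
  vertexGroup : V → Type u
  vertexGroup_group : ∀ s, Group (vertexGroup s)
  edgeGroup : E → Type u
  edgeGroup_group : ∀ a, Group (edgeGroup a)
  phi : ∀ a : E, edgeGroup a →* vertexGroup (o a)
  phiNeg : ∀ a : E, edgeGroup a →* vertexGroup (e a)
  phi_injective : ∀ a, Function.Injective (phi a)
  phiNeg_injective : ∀ a, Function.Injective (phiNeg a)

namespace GraphOfGroups

attribute [instance] vertexGroup_group edgeGroup_group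

variable {V : Type v} {E : Type w}

/-- `GPath 𝒢 s t`: the sequences `(g₀, a₁, g₁, …, aₙ, gₙ)`, `n ≥ 0`, where `(a₁, …, aₙ)` is an
edge path from `s` to `t` and each `gᵢ` lies in the group of the vertex reached after `i` edges.
`single g` is `(g)`, `fwd a g p` is the sequence starting with `g, a` and continuing with `p`,
`bwd a g p` is the one starting with `g, -a` and continuing with `p`. -/
inductive GPath (𝒢 : GraphOfGroups.{u} V E) : V → V → Type (max u v w)
  | single {s : V} (g : 𝒢.vertexGroup s) : GPath 𝒢 s s
  | fwd {t : V} (a : E) (g : 𝒢.vertexGroup (𝒢.o a)) (p : GPath 𝒢 (𝒢.e a) t) : GPath 𝒢 (𝒢.o a) t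
  | bwd {t : V} (a : E) (g : 𝒢.vertexGroup (𝒢.e a)) (p : GPath 𝒢 (𝒢.o a) t) : GPath 𝒢 (𝒢.e a) t

variable {𝒢 : GraphOfGroups.{u} V E}

namespace GPath

/-- Multiply the first group element of a sequence on the left. -/
def mulLeft {s t : V} (g : 𝒢.vertexGroup s) : GPath 𝒢 s t → GPath 𝒢 s t
  | single h => single (g * h)
  | fwd a h p => fwd a (g * h) p
  | bwd a h p => bwd a (g * h) p

/-- Concatenation: `(g₀, …, aₚ, gₚ) · (h₀, b₁, …) = (g₀, …, aₚ, gₚ h₀, b₁, …)`. -/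
def concat {s t r : V} : GPath 𝒢 s t → GPath 𝒢 t r → GPath 𝒢 s r
  | single g, q => mulLeft g q
  | fwd a g p, q => fwd a g (concat p q)
  | bwd a g p, q => bwd a g (concat p q)

/-- The equivalence relation generated, inside longer sequences as well, by the relations
`(g, a, φ_{-a}(h), -a, φ_a(h)⁻¹) = (g)` and `(g, a, 1, -a, g') = (g g')` for every edge `a`,
positive or negative. -/
inductive Equiv : ∀ {s t : V}, GPath 𝒢 s t → GPath 𝒢 s t → Prop
  | refl {s t : V} (p : GPath 𝒢 s t) : Equiv p p
  | symm {s t : V} {p q : GPath 𝒢 s t} : Equiv p q → Equiv q p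
  | trans {s t : V} {p q r : GPath 𝒢 s t} : Equiv p q → Equiv q r → Equiv p r
  | concat {s t r : V} {p p' : GPath 𝒢 s t} {q q' : GPath 𝒢 t r} :
      Equiv p p' → Equiv q q' → Equiv (p.concat q) (p'.concat q')
  | edge_pos (a : E) (h : 𝒢.edgeGroup a) (g : 𝒢.vertexGroup (𝒢.o a)) :
      Equiv (fwd a g (bwd a (𝒢.phiNeg a h) (single (𝒢.phi a h)⁻¹))) (single g)
  | edge_neg (a : E) (h : 𝒢.edgeGroup a) (g : 𝒢.vertexGroup (𝒢.e a)) :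
      Equiv (bwd a g (fwd a (𝒢.phi a h) (single (𝒢.phiNeg a h)⁻¹))) (single g)
  | back_pos (a : E) (g g' : 𝒢.vertexGroup (𝒢.o a)) :
      Equiv (fwd a g (bwd a 1 (single g'))) (single (g * g'))
  | back_neg (a : E) (g g' : 𝒢.vertexGroup (𝒢.e a)) :
      Equiv (bwd a g (fwd a 1 (single g'))) (single (g * g'))

/-- The inverse sequence `(gₙ⁻¹, -aₙ, …, g₁⁻¹, -a₁, g₀⁻¹)`. -/
def inv {s t : V} : GPath 𝒢 s t → GPath 𝒢 t s
  | single g => single g⁻¹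
  | fwd a g p => concat (inv p) (bwd a 1 (single g⁻¹))
  | bwd a g p => concat (inv p) (fwd a 1 (single g⁻¹))

theorem mulLeft_one {s t : V} (p : GPath 𝒢 s t) : mulLeft 1 p = p := by
  cases p <;> simp [mulLeft]

theorem mulLeft_mulLeft {s t : V} (g h : 𝒢.vertexGroup s) (p : GPath 𝒢 s t) :
    mulLeft g (mulLeft h p) = mulLeft (g * h) p := by
  cases p <;> simp [mulLeft, mul_assoc]

theorem mulLeft_concat {s t r : V} (g : 𝒢.vertexGroup s) (p : GPath 𝒢 s t) (q : GPath 𝒢 t r) :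
    (mulLeft g p).concat q = mulLeft g (p.concat q) := by
  cases p with
  | single h => exact (mulLeft_mulLeft g h q).symm
  | fwd a h p => rfl
  | bwd a h p => rfl

theorem concat_assoc {s t r m : V} (p : GPath 𝒢 s t) (q : GPath 𝒢 t r) (l : GPath 𝒢 r m) :
    (p.concat q).concat l = p.concat (q.concat l) := by
  induction p with
  | single g => simp [concat, mulLeft_concat]
  | fwd a g p ih => simp [concat, ih]
  | bwd a g p ih => simp [concat, ih]

theorem single_one_concat {s t : V} (p : GPath 𝒢 s t) : (single 1).concat p = p :=
  mulLeft_one p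

theorem concat_single_one {s t : V} (p : GPath 𝒢 s t) : p.concat (single 1) = p := by
  induction p with
  | single g => simp [concat, mulLeft]
  | fwd a g p ih => simp [concat, ih]
  | bwd a g p ih => simp [concat, ih]

theorem fwd_eq {t : V} (a : E) (g : 𝒢.vertexGroup (𝒢.o a)) (p : GPath 𝒢 (𝒢.e a) t) :
    fwd a g p = (fwd a g (single 1)).concat p := by
  simp [concat, mulLeft_one]

theorem bwd_eq {t : V} (a : E) (g : 𝒢.vertexGroup (𝒢.e a)) (p : GPath 𝒢 (𝒢.o a) t) :
    bwd a g p = (bwd a g (single 1)).concat p := by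
  simp [concat, mulLeft_one]

theorem concat_inv {s t : V} (p : GPath 𝒢 s t) : Equiv (p.concat p.inv) (single 1) := by
  induction p with
  | single g => simpa [inv, concat, mulLeft] using Equiv.refl _
  | fwd a g p ih =>
    have h1 := Equiv.concat (Equiv.concat (Equiv.refl (fwd a g (single 1))) ih)
      (Equiv.refl (bwd a 1 (single g⁻¹)))
    have h2 := Equiv.back_pos a g g⁻¹
    rw [mul_inv_cancel] at h2
    refine Equiv.trans ?_ (Equiv.trans h1 ?_)
    · simpa [inv, concat, concat_assoc, mulLeft_one] using Equiv.refl _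
    · simpa [concat, mulLeft_one, mulLeft] using h2
  | bwd a g p ih =>
    have h1 := Equiv.concat (Equiv.concat (Equiv.refl (bwd a g (single 1))) ih)
      (Equiv.refl (fwd a 1 (single g⁻¹)))
    have h2 := Equiv.back_neg a g g⁻¹
    rw [mul_inv_cancel] at h2
    refine Equiv.trans ?_ (Equiv.trans h1 ?_)
    · simpa [inv, concat, concat_assoc, mulLeft_one] using Equiv.refl _
    · simpa [concat, mulLeft_one, mulLeft] using h2

theorem inv_concat {s t : V} (p : GPath 𝒢 s t) : Equiv (p.inv.concat p) (single 1) := by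
  have h1 := concat_inv p.inv
  have h2 : Equiv p p.inv.inv := by
    have h3 := Equiv.concat (Equiv.refl p) h1
    have h4 := Equiv.concat (concat_inv p) (Equiv.refl p.inv.inv)
    rw [← concat_assoc, concat_single_one] at h3
    rw [single_one_concat] at h4
    exact h3.symm.trans h4
  exact (Equiv.concat (Equiv.refl p.inv) h2).trans h1

theorem Equiv.inv {s t : V} {p q : GPath 𝒢 s t} (h : Equiv p q) : Equiv p.inv q.inv := by
  have h1 := Equiv.concat (Equiv.refl p.inv) (concat_inv q)
  have h2 := Equiv.concat (Equiv.concat (Equiv.refl p.inv) h.symm) (Equiv.refl q.inv)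
  have h3 := Equiv.concat (inv_concat p) (Equiv.refl q.inv)
  rw [concat_single_one] at h1
  rw [single_one_concat] at h3
  rw [concat_assoc] at h2
  exact h1.symm.trans (h2.trans h3)

/-- Equivalence of loops with origin `s`. -/
def loopSetoid (𝒢 : GraphOfGroups.{u} V E) (s : V) : Setoid (GPath 𝒢 s s) where
  r := Equiv
  iseqv := ⟨Equiv.refl, Equiv.symm, Equiv.trans⟩

end GPath

/-- The fundamental group `π₁(𝒢, X, s)`: classes of loops with origin `s`. -/
def FundamentalGroup (𝒢 : GraphOfGroups.{u} V E) (s : V) : Type (max u v w) :=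
  Quotient (GPath.loopSetoid 𝒢 s)

/-- The group law is induced by concatenation of loops. -/
instance (𝒢 : GraphOfGroups.{u} V E) (s : V) : Group (FundamentalGroup 𝒢 s) where
  mul := Quotient.map₂ GPath.concat (fun _ _ h _ _ h' => GPath.Equiv.concat h h')
  one := Quotient.mk _ (GPath.single 1)
  inv := Quotient.map GPath.inv (fun _ _ h => GPath.Equiv.inv h)
  mul_assoc := by
    rintro ⟨p⟩ ⟨q⟩ ⟨r⟩
    exact congrArg (Quotient.mk _) (GPath.concat_assoc p q r)
  one_mul := by
    rintro ⟨p⟩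
    exact congrArg (Quotient.mk _) (GPath.single_one_concat p)
  mul_one := by
    rintro ⟨p⟩
    exact congrArg (Quotient.mk _) (GPath.concat_single_one p)
  inv_mul_cancel := by
    rintro ⟨p⟩
    exact Quotient.sound (GPath.inv_concat p)

/-- The natural homomorphism from the group of the vertex `s` to the fundamental group based at
`s`, sending `g` to the class of the loop `(g)`. -/
def vertexHom (𝒢 : GraphOfGroups.{u} V E) (s : V) :
    𝒢.vertexGroup s →* FundamentalGroup 𝒢 s where
  toFun g := Quotient.mk _ (GPath.single g)
  map_one' := rfl
  map_mul' _ _ := rfl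

end GraphOfGroups

/-- The vertex groups of the graph of groups defining a double: `G` at the vertex `s = false` and
`G'` at the vertex `s' = true`. -/
def DoubleVertexGroup (G G' : Type u) : Bool → Type u
  | false => G
  | true => G'

instance (G G' : Type u) [Group G] [Group G'] : ∀ s, Group (DoubleVertexGroup G G' s)
  | false => inferInstanceAs (Group G)
  | true => inferInstanceAs (Group G')

/-- The graph of groups with two vertices `s`, `s'` and `n ≥ 1` edges `α₁, …, αₙ` from `s` to `s'`,
with vertex groups `G` and its isomorphic copy `G'` and with `i`-th edge group `H i`, included in
`G`, and embedded in `G'` by the restriction of `φ`. -/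
def doubleGraph {G G' : Type u} [Group G] [Group G'] (φ : G ≃* G') {n : ℕ} (hn : 0 < n)
    (H : Fin n → Subgroup G) : GraphOfGroups.{u} Bool (Fin n) where
  finite_vertices := inferInstance
  finite_edges := inferInstance
  o _ := false
  e _ := true
  connected s t := by
    cases s <;> cases t
    · exact Relation.ReflTransGen.refl
    · exact Relation.ReflTransGen.single ⟨⟨0, hn⟩, Or.inl ⟨rfl, rfl⟩⟩
    · exact Relation.ReflTransGen.single ⟨⟨0, hn⟩, Or.inr ⟨rfl, rfl⟩⟩
    · exact Relation.ReflTransGen.refl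
  vertexGroup := DoubleVertexGroup G G'
  vertexGroup_group := inferInstance
  edgeGroup i := H i
  edgeGroup_group := inferInstance
  phi i := (H i).subtype
  phiNeg i := φ.toMonoidHom.comp (H i).subtype
  phi_injective i := (H i).subtype_injective
  phiNeg_injective i := φ.injective.comp (H i).subtype_injective

/-- The double `2G` of `G` along the subgroups `H 0, …, H (n - 1)`, the fundamental group being
based at the vertex `s` that carries `G`. -/
abbrev Double {G G' : Type u} [Group G] [Group G'] (φ : G ≃* G') {n : ℕ} (hn : 0 < n)
    (H : Fin n → Subgroup G) : Type u :=
  (doubleGraph φ hn H).FundamentalGroup false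

/-- The natural homomorphism `G → 2G`. -/
def Double.of {G G' : Type u} [Group G] [Group G'] (φ : G ≃* G') {n : ℕ} (hn : 0 < n)
    (H : Fin n → Subgroup G) : G →* Double φ hn H :=
  (doubleGraph φ hn H).vertexHom false

/-- The element of `Γ` represented by a word in the letters `x a` (coded `(a, true)`) and
`(x a)⁻¹` (coded `(a, false)`). -/
def wordValue {Γ : Type u} [Group Γ] {A : Type} (x : A → Γ) (L : List (A × Bool)) : Γ :=
  (L.map fun p => if p.2 then x p.1 else (x p.1)⁻¹).prod

/-- The conjugacy problem of `Γ` with respect to a family of generators `x`, as a decision problem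
on pairs of words: do the two words represent conjugate elements? -/
def ConjugacyProblem {Γ : Type u} [Group Γ] {A : Type} (x : A → Γ)
    (p : List (A × Bool) × List (A × Bool)) : Prop :=
  IsConj (wordValue x p.1) (wordValue x p.2)

/-! The double folds back onto `G`: send `G` to itself by the identity, `G'` to `G` by `φ⁻¹`, and
every edge to `1`. The defining relations survive because both embeddings of an edge group agree
after `φ⁻¹`. The resulting `Double.retraction` is a left inverse of `Double.of`, which gives
injectivity, and it carries a conjugation in `2G` to one in `G`; no normal form for `2G` is needed.
Replacing each letter by a word for its image therefore turns the conjugacy problem of `G` into that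
of `2G`. Finite generation is general: finitely many vertex groups and edges, carried to the base
point along chosen paths, generate. -/

namespace GraphOfGroups

variable {V : Type v} {E : Type w} {𝒢 : GraphOfGroups.{u} V E}

/-! ### Homomorphisms out of the fundamental group that kill the edges -/

namespace GPath

/-- The product of the images of the group elements of a sequence, the edges being sent to `1`. -/
def fold {K : Type*} [Group K] (f : ∀ s, 𝒢.vertexGroup s →* K) {s t : V} : GPath 𝒢 s t → K
  | single g => f _ g
  | fwd _ g p => f _ g * fold f p
  | bwd _ g p => f _ g * fold f p

theorem fold_mulLeft {K : Type*} [Group K] (f : ∀ s, 𝒢.vertexGroup s →* K) {s t : V}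
    (g : 𝒢.vertexGroup s) (p : GPath 𝒢 s t) : fold f (mulLeft g p) = f s g * fold f p := by
  cases p <;> simp [mulLeft, fold, mul_assoc]

theorem fold_concat {K : Type*} [Group K] (f : ∀ s, 𝒢.vertexGroup s →* K) {s t r : V}
    (p : GPath 𝒢 s t) (q : GPath 𝒢 t r) : fold f (p.concat q) = fold f p * fold f q := by
  induction p with
  | single g => exact fold_mulLeft f g q
  | fwd a g p ih => simp [concat, fold, ih, mul_assoc]
  | bwd a g p ih => simp [concat, fold, ih, mul_assoc]

theorem Equiv.fold_eq {K : Type*} [Group K] {f : ∀ s, 𝒢.vertexGroup s →* K}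
    (hf : ∀ a h, f _ (𝒢.phi a h) = f _ (𝒢.phiNeg a h)) {s t : V} {p q : GPath 𝒢 s t}
    (h : Equiv p q) : fold f p = fold f q := by
  induction h with
  | refl p => rfl
  | symm _ ih => exact ih.symm
  | trans _ _ ih₁ ih₂ => exact ih₁.trans ih₂
  | concat _ _ ih₁ ih₂ => rw [fold_concat, fold_concat, ih₁, ih₂]
  | edge_pos a h g => simp [fold, hf]
  | edge_neg a h g => simp [fold, hf]
  | back_pos a g g' => simp [fold]
  | back_neg a g g' => simp [fold]

end GPath

/-- A family of homomorphisms on the vertex groups that agree on the edge groups induces a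
homomorphism on the fundamental group, which kills the edges. -/
def FundamentalGroup.fold {K : Type*} [Group K] (f : ∀ s, 𝒢.vertexGroup s →* K)
    (hf : ∀ a h, f _ (𝒢.phi a h) = f _ (𝒢.phiNeg a h)) (s : V) : FundamentalGroup 𝒢 s →* K where
  toFun := Quotient.lift (GPath.fold f) fun _ _ h => GPath.Equiv.fold_eq hf h
  map_one' := (f s).map_one
  map_mul' := by
    rintro ⟨p⟩ ⟨q⟩
    exact GPath.fold_concat f p q

variable (𝒢) in
theorem nonempty_gpath (s t : V) : Nonempty (GPath 𝒢 s t) := by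
  induction 𝒢.connected s t with
  | refl => exact ⟨.single 1⟩
  | tail _ h ih =>
    obtain ⟨p⟩ := ih
    obtain ⟨a, ⟨rfl, rfl⟩ | ⟨rfl, rfl⟩⟩ := h
    · exact ⟨p.concat (.fwd a 1 (.single 1))⟩
    · exact ⟨p.concat (.bwd a 1 (.single 1))⟩

/-! ### Generators of the fundamental group -/

namespace FundamentalGroup

/-- The class of a loop. -/
def mk {s : V} (p : GPath 𝒢 s s) : FundamentalGroup 𝒢 s :=
  Quotient.mk _ p

variable {b : V} (c : ∀ s, GPath 𝒢 b s)

/-- The class of the loop at `b` obtained from a path by joining its ends to `b` along `c`. -/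
def closeUp {s t : V} (p : GPath 𝒢 s t) : FundamentalGroup 𝒢 b :=
  mk ((c s).concat (p.concat (c t).inv))

theorem closeUp_sound {s t : V} {p q : GPath 𝒢 s t} (h : GPath.Equiv p q) :
    closeUp c p = closeUp c q :=
  Quotient.sound ((GPath.Equiv.refl _).concat (h.concat (.refl _)))

/-- The detour `(c t)⁻¹ · c t` inserted at the middle vertex cancels. -/
theorem closeUp_concat {s t r : V} (p : GPath 𝒢 s t) (q : GPath 𝒢 t r) :
    closeUp c (p.concat q) = closeUp c p * closeUp c q := by
  refine Quotient.sound ?_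
  have h := (GPath.Equiv.refl ((c s).concat p)).concat
    ((GPath.inv_concat (c t)).concat (.refl (q.concat (c r).inv)))
  rw [GPath.single_one_concat] at h
  simp only [GPath.concat_assoc] at h ⊢
  exact h.symm

theorem closeUp_one (s : V) : closeUp c (.single (1 : 𝒢.vertexGroup s)) = 1 := by
  refine Quotient.sound ?_
  rw [GPath.single_one_concat]
  exact GPath.concat_inv (c s)

theorem closeUp_inv {s t : V} (p : GPath 𝒢 s t) : closeUp c p.inv = (closeUp c p)⁻¹ := by
  rw [eq_inv_iff_mul_eq_one, ← closeUp_concat, closeUp_sound c (GPath.inv_concat p), closeUp_one]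

/-- The vertex group at `s`, carried to the base point along `c`. -/
def vertexHomAlong (s : V) : 𝒢.vertexGroup s →* FundamentalGroup 𝒢 b where
  toFun g := closeUp c (.single g)
  map_one' := closeUp_one c s
  map_mul' g h := closeUp_concat c (.single g) (.single h)

/-- The loop that follows the edge `a`, joined to the base point along `c`. -/
def edgeAlong (a : E) : FundamentalGroup 𝒢 b :=
  closeUp c (.fwd a 1 (.single 1))

/-- Every path is a product of vertex elements, edges and inverse edges, and `closeUp` is
multiplicative. Stating it for arbitrary endpoints lets the induction run. -/
theorem closeUp_mem {S : Subgroup (FundamentalGroup 𝒢 b)}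
    (hv : ∀ s g, vertexHomAlong c s g ∈ S) (he : ∀ a, edgeAlong c a ∈ S) {s t : V}
    (p : GPath 𝒢 s t) : closeUp c p ∈ S := by
  induction p with
  | single g => exact hv _ g
  | fwd a g p ih =>
    have h : GPath.fwd a g p
        = (GPath.single g).concat ((GPath.fwd a 1 (.single 1)).concat p) := by
      rw [GPath.fwd_eq, ← GPath.concat_assoc]
      simp only [GPath.concat, GPath.mulLeft, mul_one]
    rw [h, closeUp_concat, closeUp_concat]
    exact S.mul_mem (hv _ g) (S.mul_mem (he a) ih)
  | bwd a g p ih =>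
    -- Following `-a` is following the inverse of `a`, so positive edges suffice as generators.
    have h : GPath.bwd a g p
        = (GPath.single g).concat ((GPath.fwd a 1 (.single 1)).inv.concat p) := by
      rw [GPath.bwd_eq, ← GPath.concat_assoc]
      simp only [GPath.inv, GPath.concat, GPath.mulLeft, mul_one, inv_one]
    rw [h, closeUp_concat, closeUp_concat, closeUp_inv]
    exact S.mul_mem (hv _ g) (S.mul_mem (S.inv_mem (he a)) ih)

/-- Closing up a loop at `b` only conjugates it by the class of `c b`. This path need not be
trivial, hence `hb`. -/
theorem closure_eq_top {S : Subgroup (FundamentalGroup 𝒢 b)}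
    (hv : ∀ s g, vertexHomAlong c s g ∈ S) (he : ∀ a, edgeAlong c a ∈ S)
    (hb : mk (c b) ∈ S) : S = ⊤ := by
  rw [eq_top_iff]
  rintro ⟨p⟩ -
  have h : closeUp c p = mk (c b) * (mk p * (mk (c b))⁻¹) := rfl
  have hp := closeUp_mem c hv he p
  rw [h, S.mul_mem_cancel_left hb, S.mul_mem_cancel_right (S.inv_mem hb)] at hp
  exact hp

variable (𝒢) in
/-- If the vertex groups are finitely generated, then so is the fundamental group. -/
theorem fg (h : ∀ s, Group.FG (𝒢.vertexGroup s)) (b : V) : Group.FG (FundamentalGroup 𝒢 b) := by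
  have := 𝒢.finite_vertices
  have := 𝒢.finite_edges
  let c : ∀ s, GPath 𝒢 b s := fun s => (𝒢.nonempty_gpath b s).some
  choose X hX hfin using fun s => Group.fg_iff.1 (h s)
  let Y : Set (FundamentalGroup 𝒢 b) :=
    (⋃ s, vertexHomAlong c s '' X s) ∪ (Set.range (edgeAlong c) ∪ {mk (c b)})
  refine Group.fg_iff.2 ⟨Y, closure_eq_top c (fun s g => ?_) (fun a => ?_) ?_, ?_⟩
  · have hg : g ∈ Subgroup.closure (X s) := hX s ▸ Subgroup.mem_top g
    have := Subgroup.mem_map_of_mem (vertexHomAlong c s) hg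
    rw [MonoidHom.map_closure] at this
    refine Subgroup.closure_mono ?_ this
    exact (Set.subset_iUnion (fun s => vertexHomAlong c s '' X s) s).trans Set.subset_union_left
  · exact Subgroup.subset_closure (Or.inr (Or.inl ⟨a, rfl⟩))
  · exact Subgroup.subset_closure (Or.inr (Or.inr rfl))
  · exact (Set.finite_iUnion fun s => (hfin s).image _).union
      ((Set.finite_range _).union (Set.finite_singleton _))

end FundamentalGroup

end GraphOfGroups

/-! ### The retraction of the double onto `G` -/

namespace Double

variable {G G' : Type u} [Group G] [Group G'] (φ : G ≃* G') {n : ℕ} (hn : 0 < n)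
  (H : Fin n → Subgroup G)

/-- The folding `2G → G`: the identity on `G`, the inverse of `φ` on the copy `G'`, trivial on the
edges. -/
def retraction : Double φ hn H →* G :=
  GraphOfGroups.FundamentalGroup.fold (𝒢 := doubleGraph φ hn H)
    (fun s => match s with
      | false => MonoidHom.id G
      | true => φ.symm.toMonoidHom)
    (fun i h => (φ.symm_apply_apply ((H i).subtype h)).symm) false

theorem retraction_of (g : G) : retraction φ hn H (of φ hn H g) = g := rfl

theorem of_injective : Function.Injective (of φ hn H) :=
  Function.LeftInverse.injective (retraction_of φ hn H)

/-- Homomorphisms preserve conjugacy: `of` gives one direction, its left inverse `retraction` the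
other. -/
theorem isConj_of_iff (g h : G) : IsConj (of φ hn H g) (of φ hn H h) ↔ IsConj g h :=
  ⟨fun hc => (retraction φ hn H).map_isConj hc, fun hc => (of φ hn H).map_isConj hc⟩

theorem fg [Group.FG G] : Group.FG (Double φ hn H) := by
  refine GraphOfGroups.FundamentalGroup.fg (doubleGraph φ hn H) (fun s => ?_) false
  cases s
  · exact inferInstanceAs (Group.FG G)
  · exact Group.fg_of_surjective (f := φ.toMonoidHom) φ.surjective

end Double

/-! ### Words and many-one reductions -/

section Words

variable {Γ : Type u} [Group Γ] {A : Type}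

theorem wordValue_append (x : A → Γ) (L M : List (A × Bool)) :
    wordValue x (L ++ M) = wordValue x L * wordValue x M := by
  simp [wordValue]

theorem exists_wordValue_eq {x : A → Γ} (hx : Subgroup.closure (Set.range x) = ⊤) (g : Γ) :
    ∃ L, wordValue x L = g := by
  have hg : g ∈ Subgroup.closure (Set.range x) := hx ▸ Subgroup.mem_top g
  induction hg using Subgroup.closure_induction_left with
  | one => exact ⟨[], rfl⟩
  | mul_left g hg h _ ih =>
    obtain ⟨a, rfl⟩ := hg
    obtain ⟨L, rfl⟩ := ih
    exact ⟨(a, true) :: L, by simp [wordValue]⟩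
  | inv_mul_cancel g hg h _ ih =>
    obtain ⟨a, rfl⟩ := hg
    obtain ⟨L, rfl⟩ := ih
    exact ⟨(a, false) :: L, by simp [wordValue]⟩

/-- If an effective substitution of letters by words computes a homomorphism that preserves and
reflects conjugacy, then it reduces the conjugacy problem of its source to that of its target. -/
theorem ConjugacyProblem.manyOneReducible_of_substitution {Δ : Type u} [Group Δ] {B : Type}
    [Primcodable A] [Primcodable B] {x : A → Γ} {y : B → Δ} (f : Γ →* Δ)
    (hf : ∀ g h, IsConj (f g) (f h) ↔ IsConj g h) {σ : A × Bool → List (B × Bool)}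
    (hσ : Primrec σ)
    (hval : ∀ p, wordValue y (σ p) = f (if p.2 then x p.1 else (x p.1)⁻¹)) :
    ConjugacyProblem x ≤₀ ConjugacyProblem y := by
  have hword : ∀ L : List (A × Bool), wordValue y (L.flatMap σ) = f (wordValue x L) := by
    intro L
    induction L with
    | nil => simp [wordValue]
    | cons p L ih =>
      rw [List.flatMap_cons, wordValue_append, ih, hval, ← map_mul]
      simp [wordValue]
  have hsub : Primrec fun L : List (A × Bool) => L.flatMap σ :=
    Primrec.list_flatMap Primrec.id (hσ.comp Primrec.snd).to₂
  refine ⟨fun p => (p.1.flatMap σ, p.2.flatMap σ),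
    ((hsub.comp Primrec.fst).pair (hsub.comp Primrec.snd)).to_comp, fun p => ?_⟩
  rw [ConjugacyProblem, ConjugacyProblem, hword, hword, hf]

end Words

theorem mainTheorem5 {G G' : Type u} [Group G] [Group G'] (φ : G ≃* G') {n : ℕ} (hn : 0 < n)
    (H : Fin n → Subgroup G) :
    Function.Injective (Double.of φ hn H) ∧
    (∀ g h : G, IsConj (Double.of φ hn H g) (Double.of φ hn H h) ↔ IsConj g h) ∧
    (Group.FG G → Group.FG (Double φ hn H)) ∧
    (∀ (k l : ℕ) (x : Fin k → G) (y : Fin l → Double φ hn H),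
      Subgroup.closure (Set.range x) = ⊤ → Subgroup.closure (Set.range y) = ⊤ →
      ConjugacyProblem x ≤₀ ConjugacyProblem y) ∧
    (∀ (A B : Type) [Primcodable A] [Primcodable B] (x : A → G) (z : B → Double φ hn H),
      Subgroup.closure (Set.range x) = ⊤ →
      Subgroup.closure (Set.range (Sum.elim (fun a => Double.of φ hn H (x a)) z)) = ⊤ →
      ConjugacyProblem x ≤₀
        ConjugacyProblem (Sum.elim (fun a => Double.of φ hn H (x a)) z)) := by
  refine ⟨Double.of_injective φ hn H, Double.isConj_of_iff φ hn H, fun _ => Double.fg φ hn H,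
    fun k l x y _ hy => ?_, fun A B _ _ x z _ _ => ?_⟩
  -- The words are chosen, not computed: a table on a finite alphabet is primitive recursive
  -- whatever its entries.
  · choose σ hσ using fun p : Fin k × Bool =>
      exists_wordValue_eq hy (Double.of φ hn H (if p.2 then x p.1 else (x p.1)⁻¹))
    exact ConjugacyProblem.manyOneReducible_of_substitution (Double.of φ hn H)
      (Double.isConj_of_iff φ hn H) (Primrec.dom_finite σ) hσ
  -- The alphabet may now be infinite, but each letter of `A` is itself a letter of `A ⊕ B`, so the
  -- substitution is a mere renaming.
  · have hσ : Primrec fun p : A × Bool => [((Sum.inl p.1 : A ⊕ B), p.2)] :=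
      Primrec.list_cons.comp ((Primrec.sumInl.comp Primrec.fst).pair Primrec.snd)
        (Primrec.const [])
    refine ConjugacyProblem.manyOneReducible_of_substitution (Double.of φ hn H)
      (Double.isConj_of_iff φ hn H) hσ ?_
    rintro ⟨a, _ | _⟩ <;> simp [wordValue]
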